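/- Let $\mathbf D\subset\mathbb R^2\cong\mathbb C$ be either the whole plane or the open unit disc, and let $b>0$ be such that the closed disc $\{|\mathbf x|\le b\}$ is contained in $\mathbf D$ (so $0<b<1$ if $\mathbf D$ is the unit disc). Let $K_0:(0,\infty)\to\mathbb R$ and $K_1:\mathbf D\times\mathbf D\to\mathbb R$ satisfy: (A1) $K_0$ is differentiable on $(0,\infty)$ and $-K_0'$ is a completely monotone function that is not identically zero; here $f:(0,\infty)\to\mathbb R$ is completely monotone if it is $C^\infty$ and $(-1)^nf^{(n)}(t)\ge 0$ for all $t>0$ and all integers $n\ge 0$. (A2) There are $a_0>0$ and $\alpha\in(0,1)$ such that $\int_0^{a_0}|K_0(t)|\,t^{-\alpha+\alpha^2}\,\mathrm dt<\infty$. (A3) $K_1\in C^k_{\mathrm{loc}}(\mathbf D^2)$ for some integer $k\ge 4$. (A4) For all $\mathbf x,\mathbf y\in\mathbf D$ and $\theta\in\mathbb R$: $K_1(\mathbf x,\mathbf y)=K_1(\mathbf y,\mathbf x)$, $K_1(\overline{\mathbf x},\overline{\mathbf y})=K_1(\mathbf x,\mathbf y)$ and $K_1(e^{i\theta}\mathbf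 x,e^{i\theta}\mathbf y)=K_1(\mathbf x,\mathbf y)$. Put $G_1(\rho_1,\theta,\rho_2,\eta)=K_1(\rho_1e^{i\theta},\rho_2e^{i\eta})$ and, for integers $n\ge 1$, $$\begin{aligned}\Omega_{n,b}={}&\int_0^{2\pi}K_0\big(2b|\sin\tfrac\eta2|\big)\cos\eta\,\mathrm d\eta-\int_0^{2\pi}K_0\big(2b|\sin\tfrac\eta2|\big)\cos(n\eta)\,\mathrm d\eta\\&-b^{-1}\int_0^{2\pi}\!\!\int_0^b\partial_{\rho_1}G_1(b,0,\rho,\eta)\,\rho\,\mathrm d\rho\,\mathrm d\eta-\int_0^{2\pi}K_1(b,be^{i\eta})\cos(n\eta)\,\mathrm d\eta .\end{aligned}$$ Then there exist an integer $m_0\ge 1$ and a constant $C>0$ such that for all integers $m\ge m_0$ and $n\ge 1$, $$\Omega_{(n+1)m,b}-\Omega_{nm,b}\ge\frac{C}{(nm)^3}.$$ In addition, for every integer $m\ge 1$, $$\lim_{n\to\infty}\Omega_{nm,b}=\int_0^{2\pi}K_0\big(2b|\sin\tfrac\eta2|\big)\cos\eta\,\mathrm d\eta-b^{-1}\int_0^{2\pi}\!\!\int_0^b\partial_{\rho_1}G_1(b,0,\rho,\eta)\,\rho\,\mathrm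 d\rho\,\mathrm d\eta .$$ -/

import Mathlib

open Set Filter Topology

noncomputable section

namespace VStates

/-- `f` is completely monotone on `(0, ∞)`: it is smooth there and
`(-1)^n f^{(n)}(t) ≥ 0` for all `n` and all `t > 0`. Only the values of `f` on `(0, ∞)` matter. -/
def IsCompletelyMonotone (f : ℝ → ℝ) : Prop :=
  ContDiffOn ℝ (⊤ : ℕ∞) f (Ioi 0) ∧
    ∀ (n : ℕ) (t : ℝ), 0 < t → 0 ≤ (-1 : ℝ) ^ n * iteratedDeriv n f t

/-- Complete monotonicity assumption on the radial profile `K₀ : (0, ∞) → ℝ`: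
`K₀` is differentiable on `(0, ∞)` and `-K₀'` is a nonzero completely monotone function. -/
def ProfileMonotone (K₀ : ℝ → ℝ) : Prop :=
  DifferentiableOn ℝ K₀ (Ioi 0) ∧
    IsCompletelyMonotone (fun t => -deriv K₀ t) ∧
    ∃ t : ℝ, 0 < t ∧ -deriv K₀ t ≠ 0

/-- Integrability assumption on the radial profile: for some `a₀ > 0` and some `α ∈ (0, 1)`,
`∫_0^{a₀} |K₀(t)| t^{-α + α²} dt < ∞`. -/
def ProfileIntegrable (K₀ : ℝ → ℝ) : Prop :=
  ∃ a₀ : ℝ, 0 < a₀ ∧ ∃ α : ℝ, α ∈ Ioo (0 : ℝ) 1 ∧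
    MeasureTheory.IntegrableOn (fun t : ℝ => |K₀ t| * t ^ (-α + α ^ 2)) (Ioo 0 a₀)

/-- Regularity assumption on the perturbation: `K₁` is of class `C^k` on the (open) set `D × D`
for some `k ≥ 4`. The plane is identified with `ℂ`. -/
def PerturbationRegular (D : Set ℂ) (K₁ : ℂ → ℂ → ℝ) : Prop :=
  ∃ k : ℕ, 4 ≤ k ∧ ContDiffOn ℝ k (fun p : ℂ × ℂ => K₁ p.1 p.2) (D ×ˢ D)

/-- Symmetry assumption on the perturbation: for `x, y ∈ D`, invariance under exchange of the
variables, under reflection across the horizontal axis and under rotations. -/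
def PerturbationSymmetric (D : Set ℂ) (K₁ : ℂ → ℂ → ℝ) : Prop :=
  ∀ x ∈ D, ∀ y ∈ D,
    K₁ x y = K₁ y x ∧
    K₁ (starRingEnd ℂ x) (starRingEnd ℂ y) = K₁ x y ∧
    ∀ θ : ℝ, K₁ (Complex.exp (θ * Complex.I) * x) (Complex.exp (θ * Complex.I) * y) = K₁ x y

/-- `G₁(ρ₁, θ, ρ₂, η) = K₁(ρ₁ e^{iθ}, ρ₂ e^{iη})`. -/
def G₁ (K₁ : ℂ → ℂ → ℝ) (ρ₁ θ ρ₂ η : ℝ) : ℝ :=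
  K₁ (ρ₁ * Complex.exp (θ * Complex.I)) (ρ₂ * Complex.exp (η * Complex.I))

/-- `λ_{n,b} = ∫_0^{2π} K₀(2b |sin(η/2)|) cos(nη) dη`. -/
def lam (K₀ : ℝ → ℝ) (b : ℝ) (n : ℕ) : ℝ :=
  ∫ η in (0 : ℝ)..(2 * Real.pi), K₀ (2 * b * |Real.sin (η / 2)|) * Real.cos (n * η)

/-- `b⁻¹ ∫_0^{2π} ∫_0^b ∂_{ρ₁} G₁(b, 0, ρ, η) ρ dρ dη`. -/
def radialDrift (K₁ : ℂ → ℂ → ℝ) (b : ℝ) : ℝ :=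
  b⁻¹ * ∫ η in (0 : ℝ)..(2 * Real.pi), ∫ ρ in (0 : ℝ)..b,
    deriv (fun ρ₁ : ℝ => G₁ K₁ ρ₁ 0 ρ η) b * ρ

/-- The unperturbed angular velocity
`Ω⁰_{n,b} = ∫_𝕋 K₀(2b|sin(η/2)|) cos η dη - ∫_𝕋 K₀(2b|sin(η/2)|) cos(nη) dη`. -/
def Omega0 (K₀ : ℝ → ℝ) (b : ℝ) (n : ℕ) : ℝ :=
  (∫ η in (0 : ℝ)..(2 * Real.pi), K₀ (2 * b * |Real.sin (η / 2)|) * Real.cos η) - lam K₀ b n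

/-- The contribution of the perturbation to the angular velocity
`Ω¹_{n,b} = -b⁻¹ ∫_0^{2π} ∫_0^b ∂_{ρ₁} G₁(b, 0, ρ, η) ρ dρ dη - ∫_𝕋 K₁(b, b e^{iη}) cos(nη) dη`. -/
def Omega1 (K₁ : ℂ → ℂ → ℝ) (b : ℝ) (n : ℕ) : ℝ :=
  -radialDrift K₁ b -
    ∫ η in (0 : ℝ)..(2 * Real.pi), K₁ b (b * Complex.exp (η * Complex.I)) * Real.cos (n * η)

/-- The angular velocity `Ω_{n,b} = Ω⁰_{n,b} + Ω¹_{n,b}`. -/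
def Omega (K₀ : ℝ → ℝ) (K₁ : ℂ → ℂ → ℝ) (b : ℝ) (n : ℕ) : ℝ :=
  Omega0 K₀ b n + Omega1 K₁ b n

end VStates

end

/-! With `s = η/2` the cosine coefficient `lam K₀ b N` becomes twice the integral of `K₀ (2b sin s)
cos (2Ns)` over `[0, π]`. Put `u = 1 - sin s`. Complete monotonicity makes `K₀ (2b(1 - u))`, up to a
constant, a power series in `u` with nonnegative coefficients (`tendsto_taylorSum_of_alternating`,
`hasSum_profileCoeff`).

Each power of `u = 1 - √(1 - cos² s)` is in turn a limit of polynomials in `cos² s` with nonnegative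
coefficients, and multiplication by `cos² s` averages `cosStep N` with its neighbours. So every
power has nonincreasing cosine coefficients (`integral_one_sub_sin_pow_mul_cosStep_nonneg`). The
linear term is computed exactly and alone gives a drop of order `N⁻³`; its coefficient is positive
because `K₀'` never vanishes.

The perturbation is `C⁴` on the circle of radius `b`, so its coefficients are `O(N⁻⁴)` and are
absorbed once `m`, hence `N = nm`, is large. The limit follows from Riemann–Lebesgue and this decay.
-/

/-! ### Differences of cosine coefficients: powers of `cos²`. -/

/-- The kernel `cos (2Ns) - cos (2(N+1)s)` that computes differences of consecutive cosine
coefficients. -/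
noncomputable def cosStep (N : ℕ) (s : ℝ) : ℝ :=
  Real.cos (2 * N * s) - Real.cos (2 * (N + 1) * s)

theorem continuous_cosStep (N : ℕ) : Continuous (cosStep N) := by
  unfold cosStep; fun_prop

theorem abs_cosStep_le (N : ℕ) (s : ℝ) : |cosStep N s| ≤ 2 := by
  unfold cosStep
  rw [abs_le]
  constructor <;> linarith [Real.cos_le_one (2 * N * s), Real.neg_one_le_cos (2 * N * s),
    Real.cos_le_one (2 * (N + 1) * s), Real.neg_one_le_cos (2 * (N + 1) * s)]

/-- Boundary case of the three-term averaging below: the missing neighbour of index `-1` equals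
`-cosStep 0`, which cancels one of the two central copies. -/
theorem cos_sq_mul_cosStep_zero (s : ℝ) :
    Real.cos s ^ 2 * cosStep 0 s = (cosStep 0 s + cosStep 1 s) / 4 := by
  have h : Real.cos (2 * (1 + 1) * s) = Real.cos (2 * (2 * s)) := by ring_nf
  simp only [cosStep, Nat.cast_zero, Nat.cast_one, zero_add, mul_zero, zero_mul, mul_one,
    Real.cos_zero, h, Real.cos_two_mul]
  ring

theorem cos_sq_mul_cosStep_succ (N : ℕ) (s : ℝ) :
    Real.cos s ^ 2 * cosStep (N + 1) s =
      (2 * cosStep (N + 1) s + cosStep (N + 2) s + cosStep N s) / 4 := by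
  have key : ∀ x : ℝ, Real.cos s ^ 2 * Real.cos x =
      (2 * Real.cos x + Real.cos (x + 2 * s) + Real.cos (x - 2 * s)) / 4 := by
    intro x
    rw [Real.cos_add, Real.cos_sub, Real.cos_two_mul]
    ring
  simp only [cosStep, mul_sub, key]
  push_cast
  ring_nf

theorem integral_cos_nat_mul {M : ℕ} (hM : M ≠ 0) :
    ∫ s in (0 : ℝ)..Real.pi, Real.cos (2 * M * s) = 0 := by
  have hM' : (2 * (M : ℝ)) ≠ 0 := by positivity
  rw [intervalIntegral.integral_comp_mul_left (fun x => Real.cos x) hM', integral_cos,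
    show 2 * (M : ℝ) * Real.pi = (2 * M : ℕ) * Real.pi by push_cast; ring, Real.sin_nat_mul_pi]
  simp

theorem integral_cosStep_succ (N : ℕ) :
    ∫ s in (0 : ℝ)..Real.pi, cosStep (N + 1) s = 0 := by
  unfold cosStep
  rw [intervalIntegral.integral_sub
    ((by fun_prop : Continuous _).intervalIntegrable _ _)
    ((by fun_prop : Continuous _).intervalIntegrable _ _), integral_cos_nat_mul (by omega)]
  have := integral_cos_nat_mul (M := N + 1 + 1) (by omega)
  push_cast at this ⊢
  rw [this, sub_zero]

theorem integral_cosStep_zero : ∫ s in (0 : ℝ)..Real.pi, cosStep 0 s = Real.pi := by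
  unfold cosStep
  rw [intervalIntegral.integral_sub
    ((by fun_prop : Continuous _).intervalIntegrable _ _)
    ((by fun_prop : Continuous _).intervalIntegrable _ _)]
  have := integral_cos_nat_mul (M := 1) one_ne_zero
  simp only [Nat.cast_one, mul_one] at this
  simp [this]

/-- Each factor `cos²` replaces `cosStep N` by a combination of neighbours with nonnegative weights.
This reduces to `k = 0`, where orthogonality gives `π` for `N = 0` and zero otherwise. -/
theorem integral_cos_sq_pow_mul_cosStep_nonneg (k N : ℕ) :
    0 ≤ ∫ s in (0 : ℝ)..Real.pi, (Real.cos s ^ 2) ^ k * cosStep N s := by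
  have hint : ∀ k N, IntervalIntegrable (fun s => (Real.cos s ^ 2) ^ k * cosStep N s)
      MeasureTheory.volume 0 Real.pi := fun k N =>
    (((Real.continuous_cos.pow 2).pow k).mul (continuous_cosStep N)).intervalIntegrable _ _
  induction k generalizing N with
  | zero =>
    simp only [pow_zero, one_mul]
    cases N with
    | zero => rw [integral_cosStep_zero]; exact Real.pi_pos.le
    | succ N => rw [integral_cosStep_succ]
  | succ k ih =>
    cases N with
    | zero =>
      have : ∀ s, (Real.cos s ^ 2) ^ (k + 1) * cosStep 0 s =
          ((Real.cos s ^ 2) ^ k * cosStep 0 s + (Real.cos s ^ 2) ^ k * cosStep 1 s) / 4 := by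
        intro s
        rw [pow_succ, mul_assoc, cos_sq_mul_cosStep_zero]; ring
      simp only [this]
      rw [intervalIntegral.integral_div, intervalIntegral.integral_add (hint _ _) (hint _ _)]
      have := ih 0; have := ih 1
      positivity
    | succ N =>
      have : ∀ s, (Real.cos s ^ 2) ^ (k + 1) * cosStep (N + 1) s =
          (2 * ((Real.cos s ^ 2) ^ k * cosStep (N + 1) s) +
            (Real.cos s ^ 2) ^ k * cosStep (N + 2) s + (Real.cos s ^ 2) ^ k * cosStep N s) / 4 := by
        intro s
        rw [pow_succ, mul_assoc, cos_sq_mul_cosStep_succ]; ring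
      simp only [this]
      rw [intervalIntegral.integral_div,
        intervalIntegral.integral_add (((hint _ _).const_mul 2).add (hint _ _)) (hint _ _),
        intervalIntegral.integral_add ((hint _ _).const_mul 2) (hint _ _),
        intervalIntegral.integral_const_mul]
      have := ih (N + 1); have := ih (N + 2); have := ih N
      positivity

/-! ### From powers of `cos²` to powers of `1 - sin`. -/

open scoped NNReal Polynomial

theorem continuous_eval₂_cos_sq (q : ℝ≥0[X]) :
    Continuous fun s : ℝ => q.eval₂ NNReal.toRealHom (Real.cos s ^ 2) := by
  simp only [Polynomial.eval₂_eq_sum_range]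
  fun_prop

theorem integral_eval₂_cos_sq_mul_cosStep_nonneg (q : ℝ≥0[X]) (N : ℕ) :
    0 ≤ ∫ s in (0 : ℝ)..Real.pi,
      q.eval₂ NNReal.toRealHom (Real.cos s ^ 2) * cosStep N s := by
  simp only [Polynomial.eval₂_eq_sum_range, Finset.sum_mul]
  rw [intervalIntegral.integral_finsetSum]
  · refine Finset.sum_nonneg fun k _ => ?_
    simp only [mul_assoc]
    rw [intervalIntegral.integral_const_mul]
    exact mul_nonneg (NNReal.coe_nonneg _) (integral_cos_sq_pow_mul_cosStep_nonneg k N)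
  · intro k _
    refine Continuous.intervalIntegrable ?_ _ _
    have := continuous_cosStep N
    fun_prop

/-- Polynomials with nonnegative coefficients that approximate `1 - √(1 - q)` from below on
`[0, 1]`. -/
noncomputable def sqrtApprox : ℕ → ℝ≥0[X]
  | 0 => 0
  | n + 1 => Polynomial.C (1 / 2) * (Polynomial.X + sqrtApprox n ^ 2)

/-- The iteration `p ↦ (q + p²)/2` fixes `Y = 1 - √(1 - q)`, and its error satisfies `Y - p' = (Y -
p)(Y + p)/2`. Since `0 ≤ p ≤ Y`, each step shrinks the error by a factor at most `Y`; here `q = cos²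
s` and `Y = 1 - sin s`. -/
theorem sqrtApprox_bounds (n : ℕ) {s : ℝ} (_ : 0 ≤ Real.sin s) :
    0 ≤ (sqrtApprox n).eval₂ NNReal.toRealHom (Real.cos s ^ 2) ∧
    (sqrtApprox n).eval₂ NNReal.toRealHom (Real.cos s ^ 2) ≤ 1 - Real.sin s ∧
    1 - Real.sin s - (sqrtApprox n).eval₂ NNReal.toRealHom (Real.cos s ^ 2) ≤
      (1 - Real.sin s) ^ (n + 1) := by
  have h1 := Real.sin_le_one s
  have hc : Real.cos s ^ 2 = 2 * (1 - Real.sin s) - (1 - Real.sin s) ^ 2 := by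
    rw [Real.cos_sq']; ring
  induction n with
  | zero => simp [sqrtApprox, h1]
  | succ n ih =>
    obtain ⟨h0, hY, hb⟩ := ih
    simp only [sqrtApprox, Polynomial.eval₂_mul, Polynomial.eval₂_C, Polynomial.eval₂_add,
      Polynomial.eval₂_X, Polynomial.eval₂_pow]
    generalize (sqrtApprox n).eval₂ NNReal.toRealHom (Real.cos s ^ 2) = p at *
    have e : NNReal.toRealHom (1 / 2) = (1 / 2 : ℝ) := by simp
    rw [e, hc]
    have hYY : 0 ≤ 1 - Real.sin s := by linarith
    generalize 1 - Real.sin s = Y at *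
    have hY1 : Y - 1 / 2 * (2 * Y - Y ^ 2 + p ^ 2) = (Y - p) * ((Y + p) / 2) := by ring
    refine ⟨?_, ?_, ?_⟩
    · nlinarith
    · nlinarith
    · rw [hY1, pow_succ]
      exact mul_le_mul hb (by linarith) (by linarith) (by positivity)

theorem ae_sin_pos : ∀ᵐ s ∂MeasureTheory.volume, s ∈ uIoc 0 Real.pi → 0 < Real.sin s := by
  have : ∀ᵐ s : ℝ ∂MeasureTheory.volume, s ≠ Real.pi :=
    MeasureTheory.Measure.ae_ne MeasureTheory.volume Real.pi
  filter_upwards [this] with s hs hmem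
  rw [uIoc_of_le Real.pi_pos.le] at hmem
  exact Real.sin_pos_of_pos_of_lt_pi hmem.1 (lt_of_le_of_ne hmem.2 hs)

theorem integral_one_sub_sin_pow_mul_cosStep_nonneg (j N : ℕ) :
    0 ≤ ∫ s in (0 : ℝ)..Real.pi, (1 - Real.sin s) ^ j * cosStep N s := by
  have hlim : Tendsto (fun n => ∫ s in (0 : ℝ)..Real.pi,
      (sqrtApprox n ^ j).eval₂ NNReal.toRealHom (Real.cos s ^ 2) * cosStep N s) atTop
      (𝓝 (∫ s in (0 : ℝ)..Real.pi, (1 - Real.sin s) ^ j * cosStep N s)) := by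
    refine intervalIntegral.tendsto_integral_filter_of_dominated_convergence (fun _ => 2)
      (Eventually.of_forall fun n => ?_) (Eventually.of_forall fun n => ?_) (by simp) ?_
    · exact ((continuous_eval₂_cos_sq _).mul (continuous_cosStep N)).aestronglyMeasurable
    · filter_upwards [ae_sin_pos] with s hs hmem
      obtain ⟨h0, h1, -⟩ := sqrtApprox_bounds n (hs hmem).le
      have h2 : (sqrtApprox n).eval₂ NNReal.toRealHom (Real.cos s ^ 2) ≤ 1 := by
        linarith [hs hmem]
      rw [Polynomial.eval₂_pow, norm_mul, Real.norm_eq_abs, Real.norm_eq_abs,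
        abs_of_nonneg (pow_nonneg h0 j)]
      calc _ ≤ 1 * 2 := mul_le_mul (pow_le_one₀ h0 h2) (abs_cosStep_le N s) (abs_nonneg _) zero_le_one
        _ = 2 := one_mul _
    · filter_upwards [ae_sin_pos] with s hs hmem
      simp only [Polynomial.eval₂_pow]
      refine ((Tendsto.pow ?_ j).mul_const _)
      -- The geometric error tends to zero only for `sin s > 0`, hence the almost-everywhere
      -- statement.
      have hY : Tendsto (fun n => (1 - Real.sin s) - (1 - Real.sin s) ^ (n + 1)) atTop
          (𝓝 (1 - Real.sin s)) := by
        have := (tendsto_pow_atTop_nhds_zero_of_lt_one (r := 1 - Real.sin s)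
          (by linarith [Real.sin_le_one s]) (by linarith [hs hmem]))
        simpa using ((tendsto_add_atTop_iff_nat 1).2 this).const_sub (1 - Real.sin s)
      refine tendsto_of_tendsto_of_tendsto_of_le_of_le hY tendsto_const_nhds (fun n => ?_)
        (fun n => ?_)
      · have := (sqrtApprox_bounds n (hs hmem).le).2.2
        show _ ≤ _
        linarith
      · exact (sqrtApprox_bounds n (hs hmem).le).2.1
  exact ge_of_tendsto' hlim fun n => integral_eval₂_cos_sq_mul_cosStep_nonneg _ N

/-! ### The exact contribution of the linear term `1 - sin`. -/

theorem integral_sin_mul_cos_nat (M : ℕ) :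
    ∫ s in (0 : ℝ)..Real.pi, Real.sin s * Real.cos (2 * M * s) = -2 / (4 * (M : ℝ) ^ 2 - 1) := by
  have h1 : (2 * (M : ℝ) + 1) ≠ 0 := by positivity
  have h2 : (2 * (M : ℝ) - 1) ≠ 0 := by
    intro h
    have : (2 * M : ℤ) = 1 := by exact_mod_cast (by linarith : (2 * (M : ℝ)) = 1)
    omega
  have e : ∀ s : ℝ, Real.sin s * Real.cos (2 * M * s) =
      (Real.sin ((2 * M + 1) * s) - Real.sin ((2 * M - 1) * s)) / 2 := by
    intro s
    rw [add_mul, sub_mul, one_mul, Real.sin_add, Real.sin_sub]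
    ring
  have c1 : Real.cos ((2 * M + 1) * Real.pi) = -1 := by
    rw [show (2 * (M : ℝ) + 1) * Real.pi = M * (2 * Real.pi) + Real.pi by ring]
    exact Real.cos_nat_mul_two_pi_add_pi M
  have c2 : Real.cos ((2 * M - 1) * Real.pi) = -1 := by
    rw [show (2 * (M : ℝ) - 1) * Real.pi = M * (2 * Real.pi) - Real.pi by ring]
    exact Real.cos_nat_mul_two_pi_sub_pi M
  simp only [e]
  rw [intervalIntegral.integral_div, intervalIntegral.integral_sub
    ((by fun_prop : Continuous _).intervalIntegrable _ _)
    ((by fun_prop : Continuous _).intervalIntegrable _ _),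
    intervalIntegral.integral_comp_mul_left (fun x => Real.sin x) h1,
    intervalIntegral.integral_comp_mul_left (fun x => Real.sin x) h2, integral_sin, integral_sin,
    c1, c2]
  simp only [mul_zero, Real.cos_zero, smul_eq_mul]
  rw [show (4 * (M : ℝ) ^ 2 - 1) = (2 * M + 1) * (2 * M - 1) by ring]
  field_simp
  ring

theorem integral_one_sub_sin_mul_cosStep_ge {N : ℕ} (hN : 1 ≤ N) :
    1 / (4 * (N : ℝ) ^ 3) ≤ ∫ s in (0 : ℝ)..Real.pi, (1 - Real.sin s) * cosStep N s := by
  have e : ∀ s, (1 - Real.sin s) * cosStep N s = cosStep N s -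
      (Real.sin s * Real.cos (2 * N * s) - Real.sin s * Real.cos (2 * (N + 1 : ℕ) * s)) := by
    intro s; simp only [cosStep]; push_cast; ring
  simp only [e]
  have hc : ∫ s in (0 : ℝ)..Real.pi, cosStep N s = 0 := by
    obtain ⟨M, rfl⟩ := Nat.exists_eq_add_of_le' hN
    exact integral_cosStep_succ M
  rw [intervalIntegral.integral_sub ((continuous_cosStep N).intervalIntegrable _ _)
    ((by fun_prop : Continuous _).intervalIntegrable _ _), intervalIntegral.integral_sub
    ((by fun_prop : Continuous _).intervalIntegrable _ _)
    ((by fun_prop : Continuous _).intervalIntegrable _ _), hc, integral_sin_mul_cos_nat,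
    integral_sin_mul_cos_nat]
  have hN' : (1 : ℝ) ≤ N := by exact_mod_cast hN
  push_cast
  have h1 : (0 : ℝ) < 2 * N - 1 := by linarith
  have h2 : (0 : ℝ) < 2 * N + 1 := by linarith
  have h3 : (0 : ℝ) < 2 * N + 3 := by linarith
  -- This closed form is the source of the `N⁻³` rate.
  have e2 : 0 - (-2 / (4 * (N : ℝ) ^ 2 - 1) - -2 / (4 * ((N : ℝ) + 1) ^ 2 - 1)) =
      8 / ((2 * N - 1) * (2 * N + 1) * (2 * N + 3)) := by
    rw [show (4 * (N : ℝ) ^ 2 - 1) = (2 * N - 1) * (2 * N + 1) by ring,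
      show (4 * ((N : ℝ) + 1) ^ 2 - 1) = (2 * N + 1) * (2 * N + 3) by ring]
    field_simp
    ring
  rw [e2, div_le_div_iff₀ (by positivity) (by positivity)]
  nlinarith [sq_nonneg ((N : ℝ) - 1), pow_pos (by linarith : (0 : ℝ) < N) 2, pow_pos (by linarith : (0 : ℝ) < N) 3, mul_nonneg (sub_nonneg.2 hN') (sq_nonneg (N : ℝ))]

/-! ### Taylor series of functions with alternating derivatives. -/

theorem hasDerivAt_iteratedDeriv_of_contDiffOn_Ioi {f : ℝ → ℝ}
    (hf : ContDiffOn ℝ (⊤ : ℕ∞) f (Ioi 0)) (n : ℕ) {t : ℝ} (ht : 0 < t) :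
    HasDerivAt (iteratedDeriv n f) (iteratedDeriv (n + 1) f t) t := by
  induction n generalizing f with
  | zero =>
    have h := ((contDiffOn_infty_iff_deriv_of_isOpen isOpen_Ioi).1 hf).1
    rw [iteratedDeriv_one, iteratedDeriv_zero]
    exact (h.differentiableAt (isOpen_Ioi.mem_nhds ht)).hasDerivAt
  | succ n ih =>
    rw [iteratedDeriv_succ', iteratedDeriv_succ']
    exact ih ((contDiffOn_infty_iff_deriv_of_isOpen isOpen_Ioi).1 hf).2

/-- The degree-`n` Taylor polynomial of `f` at `t`, evaluated at `x`. -/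
noncomputable def taylorSum (f : ℝ → ℝ) (n : ℕ) (x t : ℝ) : ℝ :=
  ∑ k ∈ Finset.range (n + 1), iteratedDeriv k f t / k.factorial * (x - t) ^ k

theorem taylorSum_self (f : ℝ → ℝ) (n : ℕ) (x : ℝ) : taylorSum f n x x = f x := by
  simp [taylorSum, Finset.sum_range_succ']

/-- Differentiating in the base point telescopes, leaving only the top-order term. -/
theorem hasDerivAt_taylorSum {f : ℝ → ℝ} (hf : ContDiffOn ℝ (⊤ : ℕ∞) f (Ioi 0)) (n : ℕ) (x : ℝ)
    {t : ℝ} (ht : 0 < t) :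
    HasDerivAt (taylorSum f n x) (iteratedDeriv (n + 1) f t / n.factorial * (x - t) ^ n) t := by
  induction n with
  | zero =>
    have := hasDerivAt_iteratedDeriv_of_contDiffOn_Ioi hf 0 ht
    simp only [iteratedDeriv_zero, zero_add] at this
    have e : taylorSum f 0 x = f := by funext t; simp [taylorSum]
    simpa [e] using this
  | succ n ih =>
    have h1 := (hasDerivAt_iteratedDeriv_of_contDiffOn_Ioi hf (n + 1) ht).div_const
      ((n + 1).factorial : ℝ)
    have h2 := ((hasDerivAt_id t).const_sub x).pow (n + 1)
    have h3 := ih.add (h1.mul h2)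
    have e : taylorSum f (n + 1) x = taylorSum f n x +
        (fun t => iteratedDeriv (n + 1) f t / ((n + 1).factorial : ℝ)) *
          (fun t => x - id t) ^ (n + 1) := by
      funext t
      simp [taylorSum, Finset.sum_range_succ]
    rw [e]
    refine h3.congr_deriv ?_
    have : (n.factorial : ℝ) ≠ 0 := by positivity
    simp only [Nat.factorial_succ, Nat.cast_mul, Nat.cast_add, Nat.cast_one, Pi.pow_apply, id,
      Nat.add_sub_cancel]
    field_simp
    ring

/-- If the signs of the derivatives of positive order alternate on `(0, ∞)`, the function is the
sum of its Taylor series at any `a > 0` on the interval `(0, a]`. -/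
theorem tendsto_taylorSum_of_alternating {f : ℝ → ℝ} (hf : ContDiffOn ℝ (⊤ : ℕ∞) f (Ioi 0))
    (hsign : ∀ n : ℕ, ∀ t : ℝ, 0 < t → 0 ≤ (-1 : ℝ) ^ (n + 1) * iteratedDeriv (n + 1) f t)
    {a x : ℝ} (hx : 0 < x) (hxa : x ≤ a) :
    Tendsto (fun n => taylorSum f n x a) atTop (𝓝 (f x)) := by
  -- The remainder at `x` is compared with the one at an auxiliary point `y < x`. The ratio `(t -
  -- x)/(t - y)` increases in `t`, so on `[x, a]` it is at most its value `θ < 1` at `a`.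
  set y := x / 2 with hy
  have hy0 : 0 < y := by positivity
  have hyx : y < x := by linarith
  set θ := (a - x) / (a - y) with hθ
  have hay : 0 < a - y := by linarith
  have hθ0 : 0 ≤ θ := div_nonneg (by linarith) hay.le
  have hθ1 : θ < 1 := (div_lt_one hay).2 (by linarith)
  have hθt : ∀ t ∈ Icc x a, t - x ≤ θ * (t - y) := by
    intro t ht
    rw [hθ, div_mul_eq_mul_div, le_div_iff₀ hay]
    nlinarith [mul_nonneg (sub_nonneg.2 ht.2) (sub_nonneg.2 hyx.le)]
  have hder : ∀ (n : ℕ) (z t : ℝ), 0 < t → HasDerivAt (fun t => f z - taylorSum f n z t)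
      ((-1) ^ (n + 1) * iteratedDeriv (n + 1) f t / n.factorial * (t - z) ^ n) t := by
    intro n z t ht
    refine ((hasDerivAt_taylorSum hf n z ht).const_sub (f z)).congr_deriv ?_
    rw [show t - z = (-1) * (z - t) by ring, mul_pow, pow_succ]
    have : ((-1 : ℝ) ^ n) * (-1) ^ n = 1 := by rw [← mul_pow]; simp
    linear_combination (iteratedDeriv (n + 1) f t / n.factorial * (z - t) ^ n) * this
  have hmono : ∀ (n : ℕ) (z : ℝ), 0 < z →
      MonotoneOn (fun t => f z - taylorSum f n z t) (Ici z) := by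
    intro n z hz
    refine monotoneOn_of_hasDerivWithinAt_nonneg (convex_Ici z)
      (fun t ht => (hder n z t (hz.trans_le ht)).continuousAt.continuousWithinAt)
      (fun t ht => (hder n z t ?_).hasDerivWithinAt) (fun t ht => ?_)
    · rw [interior_Ici] at ht; exact hz.trans ht
    · rw [interior_Ici] at ht
      exact mul_nonneg (div_nonneg (hsign n t (hz.trans ht)) (by positivity))
        (pow_nonneg (sub_nonneg.2 (le_of_lt ht)) n)
  have hnonneg : ∀ (n : ℕ) (z t : ℝ), 0 < z → z ≤ t → 0 ≤ f z - taylorSum f n z t := by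
    intro n z t hz hzt
    have := hmono n z hz self_mem_Ici hzt hzt
    simpa [taylorSum_self] using this
  have hbound : ∀ n, f x - taylorSum f n x a ≤ θ ^ n * (f y - f a) := by
    intro n
    -- Both remainders have derivatives with the same nonnegative factor, times `(t - y)ⁿ` and `(t -
    -- x)ⁿ`; the choice of `θ` makes the difference monotone.
    have h1 : MonotoneOn
        (fun t => θ ^ n * (f y - taylorSum f n y t) - (f x - taylorSum f n x t)) (Icc x a) := by
      have hd : ∀ t, 0 < t → HasDerivAt
          (fun t => θ ^ n * (f y - taylorSum f n y t) - (f x - taylorSum f n x t)) _ t :=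
        fun t ht => ((hder n y t ht).const_mul (θ ^ n)).sub (hder n x t ht)
      refine monotoneOn_of_hasDerivWithinAt_nonneg (convex_Icc x a)
        (fun t ht => (hd t (hx.trans_le ht.1)).continuousAt.continuousWithinAt)
        (fun t ht => (hd t ?_).hasDerivWithinAt) (fun t ht => ?_)
      · rw [interior_Icc] at ht; exact hx.trans ht.1
      · rw [interior_Icc] at ht
        have hc : 0 ≤ (-1) ^ (n + 1) * iteratedDeriv (n + 1) f t / n.factorial :=
          div_nonneg (hsign n t (hx.trans ht.1)) (by positivity)
        have hp : (t - x) ^ n ≤ θ ^ n * (t - y) ^ n := by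
          rw [← mul_pow]
          exact pow_le_pow_left₀ (sub_nonneg.2 ht.1.le) (hθt t ⟨ht.1.le, ht.2.le⟩) n
        nlinarith [mul_le_mul_of_nonneg_left hp hc]
    have h2 := h1 (left_mem_Icc.2 hxa) (right_mem_Icc.2 hxa) hxa
    have h3 : 0 ≤ θ ^ n * (f y - taylorSum f n y x) :=
      mul_nonneg (pow_nonneg hθ0 n) (hnonneg n y x hy0 hyx.le)
    simp only [taylorSum_self, sub_self, sub_zero] at h2
    -- All terms of positive order are nonnegative for `y < a`, which bounds the remainder at `y`
    -- independently of `n`.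
    have h4 : f a ≤ taylorSum f n y a := by
      rw [taylorSum, Finset.sum_range_succ']
      simp only [iteratedDeriv_zero, Nat.factorial_zero, Nat.cast_one, div_one, pow_zero, mul_one]
      refine le_add_of_nonneg_left (Finset.sum_nonneg fun k _ => ?_)
      rw [show y - a = (-1) * (a - y) by ring, mul_pow]
      have := mul_nonneg (div_nonneg (hsign k a (by linarith))
        (Nat.cast_nonneg (k + 1).factorial)) (pow_nonneg hay.le (k + 1))
      refine this.trans_eq ?_
      ring
    have h5 : θ ^ n * (f y - taylorSum f n y a) ≤ θ ^ n * (f y - f a) :=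
      mul_le_mul_of_nonneg_left (by linarith) (pow_nonneg hθ0 n)
    linarith
  have hz : Tendsto (fun n => f x - taylorSum f n x a) atTop (𝓝 0) := by
    refine tendsto_of_tendsto_of_tendsto_of_le_of_le tendsto_const_nhds ?_
      (fun n => hnonneg n x a hx hxa) hbound
    simpa using (tendsto_pow_atTop_nhds_zero_of_lt_one hθ0 hθ1).mul_const (f y - f a)
  simpa using hz.const_sub (f x)

/-- A zero at `x` propagates to the right by monotonicity. All Taylor coefficients at `x + t` then
vanish, and the expansion from that base point forces `f t = 0`. -/
theorem VStates.IsCompletelyMonotone.pos_of_ne_zero {f : ℝ → ℝ} (hf : VStates.IsCompletelyMonotone f)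
    (hne : ∃ t : ℝ, 0 < t ∧ f t ≠ 0) {x : ℝ} (hx : 0 < x) : 0 < f x := by
  obtain ⟨hsm, hsign⟩ := hf
  have hnn : ∀ t, 0 < t → 0 ≤ f t := fun t ht => by simpa using hsign 0 t ht
  refine lt_of_le_of_ne (hnn x hx) fun h0 => ?_
  obtain ⟨t, ht, hft⟩ := hne
  have hanti : AntitoneOn f (Ioi 0) := by
    have hd : ∀ t, 0 < t → HasDerivAt f (deriv f t) t := fun t ht => by
      simpa [iteratedDeriv_one] using hasDerivAt_iteratedDeriv_of_contDiffOn_Ioi hsm 0 ht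
    refine antitoneOn_of_deriv_nonpos (convex_Ioi 0)
      (fun t ht => (hd t ht).continuousAt.continuousWithinAt)
      (fun t ht => (hd t (by simpa using ht)).differentiableAt.differentiableWithinAt)
      (fun t ht => ?_)
    have := hsign 1 t (by simpa using ht)
    rw [iteratedDeriv_one] at this
    linarith
  have hz : ∀ s, x ≤ s → f s = 0 := fun s hs =>
    le_antisymm (h0 ▸ hanti hx (hx.trans_le hs) hs) (hnn s (hx.trans_le hs))
  have hev : f =ᶠ[𝓝 (x + t)] fun _ => 0 := by
    filter_upwards [Ioi_mem_nhds (show x < x + t by linarith)] with s hs using hz s (le_of_lt hs)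
  have hT : ∀ n, taylorSum f n t (x + t) = 0 := fun n => by
    refine Finset.sum_eq_zero fun k _ => ?_
    rw [(hev.iteratedDeriv_eq k)]
    simp
  have := tendsto_taylorSum_of_alternating hsm (fun n s hs => hsign (n + 1) s hs) ht
    (show t ≤ x + t by linarith)
  simp only [hT] at this
  exact hft (tendsto_nhds_unique this tendsto_const_nhds)

/-! ### The radial profile: integrability, expansion and coefficient decay. -/

open MeasureTheory

namespace VStates

theorem ProfileMonotone.contDiffOn {K₀ : ℝ → ℝ} (h : ProfileMonotone K₀) :
    ContDiffOn ℝ (⊤ : ℕ∞) K₀ (Ioi 0) := by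
  refine (contDiffOn_infty_iff_deriv_of_isOpen isOpen_Ioi).2 ⟨h.1, ?_⟩
  simpa using h.2.1.1.neg

theorem ProfileMonotone.alternating {K₀ : ℝ → ℝ} (h : ProfileMonotone K₀) (n : ℕ) (t : ℝ)
    (ht : 0 < t) : 0 ≤ (-1 : ℝ) ^ (n + 1) * iteratedDeriv (n + 1) K₀ t := by
  have := h.2.1.2 n t ht
  rw [iteratedDeriv_fun_neg] at this
  rw [iteratedDeriv_succ', pow_succ]
  linarith

theorem ProfileMonotone.antitoneOn {K₀ : ℝ → ℝ} (h : ProfileMonotone K₀) :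
    AntitoneOn K₀ (Ioi 0) := by
  refine antitoneOn_of_deriv_nonpos (convex_Ioi 0) h.1.continuousOn
    (by simpa using h.1) (fun t ht => ?_)
  have := h.alternating 0 t (by simpa using ht)
  simp only [zero_add, pow_one, iteratedDeriv_one] at this
  linarith

theorem ProfileMonotone.deriv_neg {K₀ : ℝ → ℝ} (h : ProfileMonotone K₀) {t : ℝ} (ht : 0 < t) :
    deriv K₀ t < 0 := by
  have := h.2.1.pos_of_ne_zero h.2.2 ht
  linarith

/-- The exponent `-α + α²` is nonpositive, so the weight is bounded below near zero. -/
theorem ProfileIntegrable.integrableOn {K₀ : ℝ → ℝ} (h : ProfileMonotone K₀)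
    (hi : ProfileIntegrable K₀) : ∃ a₀ > 0, IntegrableOn K₀ (Ioo 0 a₀) := by
  obtain ⟨a₀, ha₀, α, hα, hint⟩ := hi
  refine ⟨a₀, ha₀, ?_⟩
  have hexp : -α + α ^ 2 ≤ 0 := by nlinarith [hα.1, hα.2]
  have hpos : 0 < a₀ ^ (-α + α ^ 2) := Real.rpow_pos_of_pos ha₀ _
  refine Integrable.mono' (hint.const_mul (a₀ ^ (-α + α ^ 2))⁻¹)
    ((h.1.continuousOn.mono Ioo_subset_Ioi_self).aestronglyMeasurable measurableSet_Ioo) ?_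
  filter_upwards [ae_restrict_mem measurableSet_Ioo] with t ht
  have hle : a₀ ^ (-α + α ^ 2) ≤ t ^ (-α + α ^ 2) :=
    Real.rpow_le_rpow_of_nonpos ht.1 ht.2.le hexp
  rw [Real.norm_eq_abs, inv_mul_eq_div, le_div_iff₀ hpos]
  exact mul_le_mul_of_nonneg_left hle (abs_nonneg _)

theorem ProfileIntegrable.intervalIntegrable {K₀ : ℝ → ℝ} (h : ProfileMonotone K₀)
    (hi : ProfileIntegrable K₀) {c : ℝ} (hc : 0 < c) : IntervalIntegrable K₀ volume 0 c := by
  obtain ⟨a₀, ha₀, hint⟩ := hi.integrableOn h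
  have h1 : IntervalIntegrable K₀ volume 0 a₀ :=
    (intervalIntegrable_iff_integrableOn_Ioo_of_le ha₀.le).2 hint
  refine h1.trans (ContinuousOn.intervalIntegrable (h.1.continuousOn.mono ?_))
  intro t ht
  exact (lt_min ha₀ hc).trans_le ht.1

/-- On the first half, `sin s ≥ 2s/π` and monotonicity squeeze the integrand between `K₀ (2b)` and
`K₀ (4bs/π)`; reflection handles the second half. -/
theorem intervalIntegrable_profile_sin {K₀ : ℝ → ℝ} (h : ProfileMonotone K₀)
    (hi : ProfileIntegrable K₀) {b : ℝ} (hb : 0 < b) :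
    IntervalIntegrable (fun s => K₀ (2 * b * Real.sin s)) volume 0 Real.pi := by
  have hpi := Real.pi_pos
  have hhalf : IntervalIntegrable (fun s => K₀ (2 * b * Real.sin s)) volume 0 (Real.pi / 2) := by
    have hlin : IntervalIntegrable (fun s => K₀ (4 * b / Real.pi * s)) volume 0 (Real.pi / 2) := by
      have hc : 0 < 4 * b / Real.pi := by positivity
      have := (hi.intervalIntegrable h (by positivity : 0 < 2 * b)).comp_mul_left
        (c := 4 * b / Real.pi)
      simp only [zero_div] at this
      convert this using 1
      field_simp
      norm_num
    have hlin' := (intervalIntegrable_iff_integrableOn_Ioo_of_le (by positivity)).1 hlin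
    refine (intervalIntegrable_iff_integrableOn_Ioo_of_le (by positivity)).2 ?_
    refine Integrable.mono' (hlin'.abs.add (integrable_const |K₀ (2 * b)|)) ?_ ?_
    · refine ContinuousOn.aestronglyMeasurable ?_ measurableSet_Ioo
      refine h.1.continuousOn.comp (by fun_prop) fun s hs => ?_
      have := Real.sin_pos_of_pos_of_lt_pi hs.1 (by linarith [hs.2])
      exact mul_pos (by positivity) this
    · filter_upwards [ae_restrict_mem measurableSet_Ioo] with s hs
      have hsin := Real.sin_pos_of_pos_of_lt_pi hs.1 (by linarith [hs.2])
      have hlow : K₀ (2 * b) ≤ K₀ (2 * b * Real.sin s) :=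
        h.antitoneOn (mul_pos (by positivity) hsin) (show 0 < 2 * b by positivity)
          (mul_le_of_le_one_right (by positivity) (Real.sin_le_one s))
      have hup : K₀ (2 * b * Real.sin s) ≤ K₀ (4 * b / Real.pi * s) := by
        refine h.antitoneOn (mul_pos (by positivity) hs.1) (mul_pos (by positivity) hsin) ?_
        have := Real.mul_le_sin hs.1.le hs.2.le
        calc 4 * b / Real.pi * s = 2 * b * (2 / Real.pi * s) := by ring
          _ ≤ _ := by gcongr
      rw [Real.norm_eq_abs]
      show _ ≤ |K₀ (4 * b / Real.pi * s)| + |K₀ (2 * b)|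
      rw [abs_le]
      constructor
      · linarith [neg_abs_le (K₀ (2 * b)), abs_nonneg (K₀ (4 * b / Real.pi * s))]
      · linarith [le_abs_self (K₀ (4 * b / Real.pi * s)), abs_nonneg (K₀ (2 * b))]
  refine hhalf.trans ?_
  have := (hhalf.comp_sub_left Real.pi).symm
  simp only [Real.sin_pi_sub, sub_zero, sub_half] at this
  exact this

/-- Coefficients of the expansion of `K₀ (2b(1 - u))` in powers of `u`, without the constant
term. -/
noncomputable def profileCoeff (K₀ : ℝ → ℝ) (b : ℝ) (n : ℕ) : ℝ :=
  (-1) ^ (n + 1) * iteratedDeriv (n + 1) K₀ (2 * b) / (n + 1).factorial * (2 * b) ^ (n + 1)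

theorem profileCoeff_nonneg {K₀ : ℝ → ℝ} (h : ProfileMonotone K₀) {b : ℝ} (hb : 0 < b) (n : ℕ) :
    0 ≤ profileCoeff K₀ b n :=
  mul_nonneg (div_nonneg (h.alternating n _ (by positivity)) (by positivity)) (by positivity)

theorem profileCoeff_zero_pos {K₀ : ℝ → ℝ} (h : ProfileMonotone K₀) {b : ℝ} (hb : 0 < b) :
    0 < profileCoeff K₀ b 0 := by
  have := h.deriv_neg (show 0 < 2 * b by positivity)
  simp only [profileCoeff, zero_add, pow_one, iteratedDeriv_one, Nat.factorial_one, Nat.cast_one,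
    div_one]
  exact mul_pos (by linarith) (by positivity)

theorem hasSum_profileCoeff {K₀ : ℝ → ℝ} (h : ProfileMonotone K₀) {b : ℝ} (hb : 0 < b) {u : ℝ}
    (hu0 : 0 ≤ u) (hu1 : u < 1) :
    HasSum (fun n => profileCoeff K₀ b n * u ^ (n + 1)) (K₀ (2 * b * (1 - u)) - K₀ (2 * b)) := by
  rw [hasSum_iff_tendsto_nat_of_nonneg
    fun n => mul_nonneg (profileCoeff_nonneg h hb n) (pow_nonneg hu0 _)]
  have := (tendsto_taylorSum_of_alternating h.contDiffOn h.alternating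
    (mul_pos (show 0 < 2 * b by positivity) (sub_pos.2 hu1))
    (mul_le_of_le_one_right (show 0 ≤ 2 * b by positivity) (by linarith))).sub_const (K₀ (2 * b))
  refine this.congr fun n => ?_
  rw [taylorSum, Finset.sum_range_succ']
  simp only [iteratedDeriv_zero, Nat.factorial_zero, Nat.cast_one, div_one, pow_zero, mul_one,
    add_sub_cancel_right]
  refine Finset.sum_congr rfl fun k _ => ?_
  rw [profileCoeff, show 2 * b * (1 - u) - 2 * b = (-1) * (2 * b) * u by ring, mul_pow, mul_pow]
  ring

/-- The power series is integrated termwise, and all terms but the linear one are dropped as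
nonnegative. The constant `K₀ (2b)` is invisible because `cosStep N` has mean zero for `N ≥ 1`. -/
theorem integral_profile_sin_mul_cosStep_ge {K₀ : ℝ → ℝ} (h : ProfileMonotone K₀)
    (hi : ProfileIntegrable K₀) {b : ℝ} (hb : 0 < b) {N : ℕ} (hN : 1 ≤ N) :
    profileCoeff K₀ b 0 * (1 / (4 * (N : ℝ) ^ 3)) ≤
      ∫ s in (0 : ℝ)..Real.pi, K₀ (2 * b * Real.sin s) * cosStep N s := by
  have hK := intervalIntegrable_profile_sin h hi hb
  have hKc : IntervalIntegrable (fun s => K₀ (2 * b * Real.sin s) - K₀ (2 * b)) volume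
      0 Real.pi := hK.sub (by simp)
  have hsum : ∀ s, 0 < Real.sin s → HasSum
      (fun n => profileCoeff K₀ b n * (1 - Real.sin s) ^ (n + 1))
      (K₀ (2 * b * Real.sin s) - K₀ (2 * b)) := by
    intro s hs
    have := hasSum_profileCoeff h hb (u := 1 - Real.sin s) (by linarith [Real.sin_le_one s])
      (by linarith)
    rwa [sub_sub_cancel] at this
  have hterm : ∀ s k, 0 ≤ profileCoeff K₀ b k * (1 - Real.sin s) ^ (k + 1) := fun s k =>
    mul_nonneg (profileCoeff_nonneg h hb k) (pow_nonneg (by linarith [Real.sin_le_one s]) _)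
  have hlim : Tendsto (fun n => ∫ s in (0 : ℝ)..Real.pi,
      (∑ k ∈ Finset.range (n + 1), profileCoeff K₀ b k * (1 - Real.sin s) ^ (k + 1)) *
        cosStep N s) atTop
      (𝓝 (∫ s in (0 : ℝ)..Real.pi,
        (K₀ (2 * b * Real.sin s) - K₀ (2 * b)) * cosStep N s)) := by
    refine intervalIntegral.tendsto_integral_filter_of_dominated_convergence
      (fun s => (K₀ (2 * b * Real.sin s) - K₀ (2 * b)) * 2)
      (Eventually.of_forall fun n => ?_) (Eventually.of_forall fun n => ?_) (hKc.mul_const 2) ?_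
    · have := continuous_cosStep N
      exact (by fun_prop : Continuous _).aestronglyMeasurable
    · filter_upwards [ae_sin_pos] with s hs hmem
      rw [norm_mul, Real.norm_eq_abs, Real.norm_eq_abs,
        abs_of_nonneg (Finset.sum_nonneg fun k _ => hterm s k)]
      have hle := sum_le_hasSum (Finset.range (n + 1)) (fun k _ => hterm s k) (hsum s (hs hmem))
      exact mul_le_mul hle (abs_cosStep_le N s) (abs_nonneg _)
        ((hsum s (hs hmem)).nonneg (hterm s))
    · filter_upwards [ae_sin_pos] with s hs hmem
      exact (((tendsto_add_atTop_iff_nat 1).2 (hsum s (hs hmem)).tendsto_sum_nat)).mul_const _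
  have hpart : ∀ n, profileCoeff K₀ b 0 * (1 / (4 * (N : ℝ) ^ 3)) ≤ ∫ s in (0 : ℝ)..Real.pi,
      (∑ k ∈ Finset.range (n + 1), profileCoeff K₀ b k * (1 - Real.sin s) ^ (k + 1)) *
        cosStep N s := by
    intro n
    simp only [Finset.sum_mul, mul_assoc]
    rw [intervalIntegral.integral_finsetSum, Finset.sum_range_succ']
    · simp only [intervalIntegral.integral_const_mul, zero_add, pow_one]
      have h0 := mul_le_mul_of_nonneg_left (integral_one_sub_sin_mul_cosStep_ge hN)
        (profileCoeff_nonneg h hb 0)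
      exact h0.trans (le_add_of_nonneg_left (Finset.sum_nonneg fun k _ =>
        mul_nonneg (profileCoeff_nonneg h hb _)
          (integral_one_sub_sin_pow_mul_cosStep_nonneg _ N)))
    · intro k _
      have := continuous_cosStep N
      exact (by fun_prop : Continuous _).intervalIntegrable _ _
  have hge := ge_of_tendsto' hlim hpart
  have hzero : ∫ s in (0 : ℝ)..Real.pi, cosStep N s = 0 := by
    obtain ⟨M, rfl⟩ := Nat.exists_eq_add_of_le' hN
    exact integral_cosStep_succ M
  simp only [sub_mul] at hge
  rwa [intervalIntegral.integral_sub
    (hK.mul_continuousOn (continuous_cosStep N).continuousOn)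
    (((continuous_cosStep N).intervalIntegrable _ _).const_mul _),
    intervalIntegral.integral_const_mul, hzero, mul_zero, sub_zero] at hge

theorem lam_eq_integral_sin (K₀ : ℝ → ℝ) (b : ℝ) (N : ℕ) :
    lam K₀ b N =
      2 * ∫ s in (0 : ℝ)..Real.pi, K₀ (2 * b * Real.sin s) * Real.cos (2 * N * s) := by
  have := intervalIntegral.integral_comp_div (a := 0) (b := 2 * Real.pi)
    (fun s => K₀ (2 * b * |Real.sin s|) * Real.cos (2 * N * s)) (two_ne_zero (α := ℝ))
  rw [zero_div, mul_div_cancel_left₀ _ (two_ne_zero (α := ℝ)), smul_eq_mul] at this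
  rw [lam]
  convert this using 2
  · funext η
    congr 2
    ring
  · refine intervalIntegral.integral_congr_ae ?_
    filter_upwards [ae_sin_pos] with s hs hmem
    rw [abs_of_pos (hs hmem)]

theorem lam_sub_lam_succ_ge {K₀ : ℝ → ℝ} (h : ProfileMonotone K₀)
    (hi : ProfileIntegrable K₀) {b : ℝ} (hb : 0 < b) {N : ℕ} (hN : 1 ≤ N) :
    profileCoeff K₀ b 0 / 2 / (N : ℝ) ^ 3 ≤ lam K₀ b N - lam K₀ b (N + 1) := by
  have hK := intervalIntegrable_profile_sin h hi hb
  have hge := integral_profile_sin_mul_cosStep_ge h hi hb hN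
  have e : ∀ s, K₀ (2 * b * Real.sin s) * cosStep N s =
      K₀ (2 * b * Real.sin s) * Real.cos (2 * N * s) -
        K₀ (2 * b * Real.sin s) * Real.cos (2 * (N + 1 : ℕ) * s) := by
    intro s; simp only [cosStep]; push_cast; ring
  simp only [e] at hge
  rw [intervalIntegral.integral_sub
    (hK.mul_continuousOn (by fun_prop : Continuous _).continuousOn)
    (hK.mul_continuousOn (by fun_prop : Continuous _).continuousOn)] at hge
  rw [lam_eq_integral_sin, lam_eq_integral_sin, ← mul_sub]
  refine le_trans (le_of_eq ?_) (mul_le_mul_of_nonneg_left hge zero_le_two)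
  have : (N : ℝ) ≠ 0 := by positivity
  field_simp
  norm_num

/-- In the telescoping sum the first step alone gives the bound; the later ones are nonnegative. -/
theorem lam_sub_lam_ge {K₀ : ℝ → ℝ} (h : ProfileMonotone K₀)
    (hi : ProfileIntegrable K₀) {b : ℝ} (hb : 0 < b) {N M : ℕ} (hN : 1 ≤ N) (hM : 1 ≤ M) :
    profileCoeff K₀ b 0 / 2 / (N : ℝ) ^ 3 ≤ lam K₀ b N - lam K₀ b (N + M) := by
  induction M, hM using Nat.le_induction with
  | base => exact lam_sub_lam_succ_ge h hi hb hN
  | succ M _ ih =>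
    have h1 := lam_sub_lam_succ_ge h hi hb (show 1 ≤ N + M by omega)
    have h2 : 0 ≤ profileCoeff K₀ b 0 / 2 / ((N + M : ℕ) : ℝ) ^ 3 := by
      have := profileCoeff_nonneg h hb 0
      positivity
    rw [← add_assoc]
    linarith

end VStates

/-! ### Riemann–Lebesgue and Fourier decay of the perturbation. -/

theorem tendsto_integral_mul_cos_two_mul {f : ℝ → ℝ} (hf : IntervalIntegrable f volume 0 Real.pi) :
    Tendsto (fun N : ℕ => ∫ s in (0 : ℝ)..Real.pi, f s * Real.cos (2 * N * s)) atTop (𝓝 0) := by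
  have hpi := Real.pi_pos
  set F : ℝ → ℂ := (Ioc 0 Real.pi).indicator fun s => (f s : ℂ) with hF
  have hFi : Integrable F := by
    rw [hF, integrable_indicator_iff measurableSet_Ioc]
    exact ((intervalIntegrable_iff_integrableOn_Ioc_of_le hpi.le).1 hf).ofReal
  -- Frequency `N/π` turns the kernel `exp (-2πi s w)` into `exp (-2iNs)`, whose real part is the
  -- required cosine.
  have hw : Tendsto (fun N : ℕ => (N : ℝ) / Real.pi) atTop (cocompact ℝ) :=
    (tendsto_natCast_atTop_atTop.atTop_div_const hpi).mono_right atTop_le_cocompact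
  have h := (Complex.continuous_re.tendsto 0).comp
    ((Real.tendsto_integral_exp_smul_cocompact F).comp hw)
  rw [Complex.zero_re] at h
  refine h.congr fun N => ?_
  simp only [Function.comp_apply]
  rw [← Complex.reCLM_apply, ← ContinuousLinearMap.integral_comp_comm,
    intervalIntegral.integral_of_le hpi.le, ← integral_indicator measurableSet_Ioc]
  · congr 1
    funext s
    by_cases hs : s ∈ Ioc 0 Real.pi
    · simp only [hF, indicator_of_mem hs]
      rw [Circle.smul_def, Real.fourierChar_apply, smul_eq_mul, Complex.reCLM_apply,
        Complex.re_mul_ofReal, Complex.exp_ofReal_mul_I_re,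
        show 2 * Real.pi * -(s * (N / Real.pi)) = -(2 * N * s) by field_simp, Real.cos_neg,
        mul_comm]
    · simp [hF, indicator_of_notMem hs]
  · have hconv := (Real.fourierIntegral_convergent_iff (N / Real.pi : ℝ)).2 hFi
    refine hconv.congr (Eventually.of_forall fun s => ?_)
    simp only [RCLike.inner_apply, conj_trivial]
    rw [mul_comm]

theorem periodic_deriv {g : ℝ → ℝ} {c : ℝ} (hp : Function.Periodic g c) :
    Function.Periodic (deriv g) c := fun x => by
  rw [← deriv_comp_add_const]
  congr 1
  funext y
  exact hp y

/-- The boundary terms vanish because the sine is zero at both ends. -/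
theorem integral_mul_cos_eq_of_periodic {g : ℝ → ℝ} (hg : ContDiff ℝ 1 g) {N : ℕ} (hN : 1 ≤ N) :
    ∫ η in (0 : ℝ)..(2 * Real.pi), g η * Real.cos (N * η) =
      -((N : ℝ)⁻¹ * ∫ η in (0 : ℝ)..(2 * Real.pi), deriv g η * Real.sin (N * η)) := by
  have hN0 : (N : ℝ) ≠ 0 := by positivity
  have hv : ∀ x : ℝ, HasDerivAt (fun η : ℝ => Real.sin (N * η) / N) (Real.cos (N * x)) x := by
    intro x
    refine ((((hasDerivAt_id x).const_mul (N : ℝ)).sin).div_const (N : ℝ)).congr_deriv ?_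
    simp only [id]
    field_simp
  have hs : Real.sin (N * (2 * Real.pi)) = 0 := by
    rw [← mul_assoc]
    exact_mod_cast Real.sin_nat_mul_pi (N * 2)
  rw [intervalIntegral.integral_mul_deriv_eq_deriv_mul
    (fun x _ => (hg.differentiable one_ne_zero x).hasDerivAt) (fun x _ => hv x)
    ((hg.continuous_deriv le_rfl).intervalIntegrable _ _)
    ((by fun_prop : Continuous _).intervalIntegrable _ _), hs,
    ← intervalIntegral.integral_const_mul]
  simp only [mul_zero, Real.sin_zero, zero_div, sub_zero, zero_sub]
  congr 2
  funext η
  ring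

/-- Here the boundary cosines equal one, and periodicity of `g` makes them cancel. -/
theorem integral_mul_sin_eq_of_periodic {g : ℝ → ℝ} (hg : ContDiff ℝ 1 g)
    (hp : Function.Periodic g (2 * Real.pi)) {N : ℕ} (hN : 1 ≤ N) :
    ∫ η in (0 : ℝ)..(2 * Real.pi), g η * Real.sin (N * η) =
      (N : ℝ)⁻¹ * ∫ η in (0 : ℝ)..(2 * Real.pi), deriv g η * Real.cos (N * η) := by
  have hN0 : (N : ℝ) ≠ 0 := by positivity
  have hv : ∀ x : ℝ, HasDerivAt (fun η : ℝ => -Real.cos (N * η) / N) (Real.sin (N * x)) x := by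
    intro x
    refine ((((hasDerivAt_id x).const_mul (N : ℝ)).cos.neg).div_const (N : ℝ)).congr_deriv ?_
    simp only [id]
    field_simp
  have hs : Real.cos (N * (2 * Real.pi)) = 1 := Real.cos_nat_mul_two_pi N
  have h0 : g (2 * Real.pi) = g 0 := by simpa using hp 0
  rw [intervalIntegral.integral_mul_deriv_eq_deriv_mul
    (fun x _ => (hg.differentiable one_ne_zero x).hasDerivAt) (fun x _ => hv x)
    ((hg.continuous_deriv le_rfl).intervalIntegrable _ _)
    ((by fun_prop : Continuous _).intervalIntegrable _ _), hs, h0,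
    ← intervalIntegral.integral_const_mul]
  simp only [mul_zero, Real.cos_zero, sub_self, zero_sub, ← intervalIntegral.integral_neg]
  congr 1
  funext η
  ring

/-- Fourier cosine coefficients of a periodic `C⁴` function are `O(N⁻⁴)`. -/
theorem exists_abs_integral_mul_cos_le {g : ℝ → ℝ} (hg : ContDiff ℝ 4 g)
    (hp : Function.Periodic g (2 * Real.pi)) :
    ∃ A : ℝ, 0 ≤ A ∧ ∀ N : ℕ, 1 ≤ N →
      |∫ η in (0 : ℝ)..(2 * Real.pi), g η * Real.cos (N * η)| ≤ A / (N : ℝ) ^ 4 := by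
  have hpi := Real.pi_pos
  have h1 : ContDiff ℝ 3 (deriv g) := (contDiff_succ_iff_deriv (n := 3)).1 hg |>.2.2
  have h2 : ContDiff ℝ 2 (deriv (deriv g)) := (contDiff_succ_iff_deriv (n := 2)).1 h1 |>.2.2
  have h3 : ContDiff ℝ 1 (deriv (deriv (deriv g))) :=
    (contDiff_succ_iff_deriv (n := 1)).1 h2 |>.2.2
  have h4 : Continuous (deriv (deriv (deriv (deriv g)))) := h3.continuous_deriv le_rfl
  have p1 := periodic_deriv hp
  have p3 := periodic_deriv (periodic_deriv p1)
  refine ⟨∫ η in (0 : ℝ)..(2 * Real.pi), |deriv (deriv (deriv (deriv g))) η|,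
    intervalIntegral.integral_nonneg (by positivity) fun _ _ => abs_nonneg _, fun N hN => ?_⟩
  have hN0 : (0 : ℝ) < N := by positivity
  rw [integral_mul_cos_eq_of_periodic (hg.of_le (by norm_num)) hN,
    integral_mul_sin_eq_of_periodic (h1.of_le (by norm_num)) p1 hN,
    integral_mul_cos_eq_of_periodic (h2.of_le (by norm_num)) hN,
    integral_mul_sin_eq_of_periodic h3 p3 hN]
  have hb : |∫ η in (0 : ℝ)..(2 * Real.pi),
      deriv (deriv (deriv (deriv g))) η * Real.cos (N * η)| ≤
      ∫ η in (0 : ℝ)..(2 * Real.pi), |deriv (deriv (deriv (deriv g))) η| := by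
    refine (intervalIntegral.abs_integral_le_integral_abs (by positivity)).trans ?_
    refine intervalIntegral.integral_mono_on (by positivity)
      ((by fun_prop : Continuous _).intervalIntegrable _ _)
      ((by fun_prop : Continuous _).intervalIntegrable _ _) fun η _ => ?_
    rw [abs_mul]
    exact mul_le_of_le_one_right (abs_nonneg _) (Real.abs_cos_le_one _)
  generalize (∫ η in (0 : ℝ)..(2 * Real.pi),
      deriv (deriv (deriv (deriv g))) η * Real.cos (N * η)) = I at *
  rw [show -((N : ℝ)⁻¹ * ((N : ℝ)⁻¹ * -((N : ℝ)⁻¹ * ((N : ℝ)⁻¹ * I)))) = I / (N : ℝ) ^ 4 by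
    field_simp, abs_div, abs_of_pos (by positivity : (0 : ℝ) < (N : ℝ) ^ 4)]
  exact div_le_div_of_nonneg_right hb (by positivity)

namespace VStates

theorem tendsto_lam {K₀ : ℝ → ℝ} (h : ProfileMonotone K₀) (hi : ProfileIntegrable K₀) {b : ℝ}
    (hb : 0 < b) : Tendsto (lam K₀ b) atTop (𝓝 0) := by
  have := (tendsto_integral_mul_cos_two_mul (intervalIntegrable_profile_sin h hi hb)).const_mul 2
  rw [mul_zero] at this
  exact this.congr fun N => (lam_eq_integral_sin K₀ b N).symm

theorem contDiff_perturbation_circle {D : Set ℂ} {b : ℝ} (hb : 0 < b)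
    (hbD : Metric.closedBall (0 : ℂ) b ⊆ D) {K₁ : ℂ → ℂ → ℝ} (hA3 : PerturbationRegular D K₁) :
    ContDiff ℝ 4 fun η : ℝ => K₁ b (b * Complex.exp (η * Complex.I)) := by
  obtain ⟨k, hk, hK⟩ := hA3
  have hK4 : ContDiffOn ℝ 4 (fun p : ℂ × ℂ => K₁ p.1 p.2) (D ×ˢ D) :=
    hK.of_le (by exact_mod_cast hk)
  have hc : ContDiff ℝ 4 fun η : ℝ => ((b : ℂ), (b : ℂ) * Complex.exp (η * Complex.I)) := by
    refine contDiff_const.prodMk (contDiff_const.mul (ContDiff.cexp ?_))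
    exact Complex.ofRealCLM.contDiff.mul contDiff_const
  refine hK4.comp_contDiff hc fun η => ⟨hbD ?_, hbD ?_⟩
  · simp [abs_of_pos hb]
  · simp [abs_of_pos hb, Complex.norm_exp_ofReal_mul_I]

theorem periodic_perturbation_circle (K₁ : ℂ → ℂ → ℝ) (b : ℝ) :
    Function.Periodic (fun η : ℝ => K₁ b (b * Complex.exp (η * Complex.I))) (2 * Real.pi) := by
  intro η
  have : Complex.exp (((η + 2 * Real.pi : ℝ) : ℂ) * Complex.I) = Complex.exp (η * Complex.I) := by
    push_cast
    rw [add_mul]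
    exact Complex.exp_periodic _
  simp only [this]

end VStates

/-! ### Absorbing the perturbation, and the limit. -/

theorem lemma4p3
    (D : Set ℂ) (hD : D = Set.univ ∨ D = Metric.ball (0 : ℂ) 1)
    (b : ℝ) (hb : 0 < b) (hbD : Metric.closedBall (0 : ℂ) b ⊆ D)
    (K₀ : ℝ → ℝ) (K₁ : ℂ → ℂ → ℝ)
    (hA1 : VStates.ProfileMonotone K₀)
    (hA2 : VStates.ProfileIntegrable K₀)
    (hA3 : VStates.PerturbationRegular D K₁)
    (hA4 : VStates.PerturbationSymmetric D K₁) :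
    (∃ m₀ : ℕ, 1 ≤ m₀ ∧ ∃ C : ℝ, 0 < C ∧ ∀ m : ℕ, m₀ ≤ m → ∀ n : ℕ, 1 ≤ n →
      C / ((n : ℝ) * (m : ℝ)) ^ 3 ≤
        VStates.Omega K₀ K₁ b ((n + 1) * m) - VStates.Omega K₀ K₁ b (n * m)) ∧
    (∀ m : ℕ, 1 ≤ m →
      Tendsto (fun n : ℕ => VStates.Omega K₀ K₁ b (n * m)) atTop
        (𝓝 ((∫ η in (0 : ℝ)..(2 * Real.pi),
              K₀ (2 * b * |Real.sin (η / 2)|) * Real.cos η) -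
            b⁻¹ * ∫ η in (0 : ℝ)..(2 * Real.pi), ∫ ρ in (0 : ℝ)..b,
              deriv (fun ρ₁ : ℝ => VStates.G₁ K₁ ρ₁ 0 ρ η) b * ρ))) := by

  have hc := VStates.profileCoeff_zero_pos hA1 hb
  set c := VStates.profileCoeff K₀ b 0 / 2 with hc_def
  have hc0 : 0 < c := by positivity
  obtain ⟨A, hA, hmu⟩ := exists_abs_integral_mul_cos_le
    (VStates.contDiff_perturbation_circle hb hbD hA3) (VStates.periodic_perturbation_circle K₁ b)
  set μ : ℕ → ℝ := fun N => ∫ η in (0 : ℝ)..(2 * Real.pi),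
    K₁ b (b * Complex.exp (η * Complex.I)) * Real.cos (N * η) with hμ_def
  have hOmega : ∀ N, VStates.Omega K₀ K₁ b N =
      ((∫ η in (0 : ℝ)..(2 * Real.pi), K₀ (2 * b * |Real.sin (η / 2)|) * Real.cos η) -
        VStates.lam K₀ b N) + (-VStates.radialDrift K₁ b - μ N) := fun N => rfl
  constructor
  -- The two perturbation coefficients cost at most `2A/N⁴`, which is at most half of `c/N³` once
  -- `cN ≥ 4A`; the other half gives `C = c/2`.
  · obtain ⟨m₁, hm₁⟩ := exists_nat_ge (4 * A / c)
    refine ⟨max 1 m₁, le_max_left _ _, c / 2, by positivity, fun m hm n hn => ?_⟩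
    have hm1 : 1 ≤ m := (le_max_left _ _).trans hm
    obtain ⟨N, hN⟩ : ∃ N, N = n * m := ⟨_, rfl⟩
    have hmN : m ≤ N := hN ▸ Nat.le_mul_of_pos_left m hn
    have hN1 : 1 ≤ N := hm1.trans hmN
    have hN0 : (0 : ℝ) < N := by exact_mod_cast hN1
    have hNA : 4 * A ≤ c * N := by
      have h1 : (m₁ : ℝ) ≤ N := by exact_mod_cast ((le_max_right _ _).trans hm).trans hmN
      exact (div_le_iff₀' hc0).1 (hm₁.trans h1)
    rw [add_mul, one_mul, ← Nat.cast_mul, ← hN, hOmega, hOmega]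
    have h1 := VStates.lam_sub_lam_ge hA1 hA2 hb hN1 hm1
    have h2 := neg_le_of_abs_le (hmu N hN1)
    have h3 := le_of_abs_le (hmu (N + m) (by omega))
    have h4 : A / ((N + m : ℕ) : ℝ) ^ 4 ≤ A / (N : ℝ) ^ 4 := by
      refine div_le_div_of_nonneg_left hA (by positivity) ?_
      gcongr
      omega
    have h5 : 2 * (A / (N : ℝ) ^ 4) ≤ c / 2 / (N : ℝ) ^ 3 := by
      rw [← mul_div_assoc, div_le_div_iff₀ (by positivity) (by positivity), pow_succ _ 3]
      have := mul_le_mul_of_nonneg_right hNA (by positivity : (0 : ℝ) ≤ (N : ℝ) ^ 3)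
      linarith
    have h6 : c / (N : ℝ) ^ 3 = c / 2 / (N : ℝ) ^ 3 + c / 2 / (N : ℝ) ^ 3 := by ring
    simp only [hμ_def]
    linarith
  · intro m hm
    have hsub : Tendsto (fun n : ℕ => n * m) atTop atTop :=
      tendsto_id.atTop_mul_const' hm
    have hlam := (VStates.tendsto_lam hA1 hA2 hb).comp hsub
    have hμ : Tendsto μ atTop (𝓝 0) := by
      have hz : Tendsto (fun N : ℕ => A / (N : ℝ) ^ 4) atTop (𝓝 0) :=
        ((tendsto_pow_atTop (by norm_num)).comp tendsto_natCast_atTop_atTop).const_div_atTop A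
      refine squeeze_zero_norm' ?_ hz
      filter_upwards [eventually_ge_atTop 1] with N hN using hmu N hN
    have := (hlam.const_sub (∫ η in (0 : ℝ)..(2 * Real.pi),
      K₀ (2 * b * |Real.sin (η / 2)|) * Real.cos η)).add
      ((hμ.comp hsub).const_sub (-VStates.radialDrift K₁ b))
    rw [sub_zero, sub_zero, ← sub_eq_add_neg] at this
    exact this
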